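/- Throughout, ${}^t g := t g t^{-1}$. A group $G$ \emph{has commuting conjugates} if for every finitely generated subgroup $H \le G$ there is $t \in G$ with $[H, {}^tH] = 1$. A group $G$ is \emph{binate} if for every finitely generated subgroup $H \le G$ there are a homomorphism $f \colon H \to G$ with $[H, f(H)] = 1$ and an element $t \in G$ such that ${}^t f(h) = h\, f(h)$ for all $h \in H$. For a group $\Gamma$ let $$b(\Gamma) := \langle \Gamma \times \Gamma,\ d \mid {}^d(1,g) = (g,g) \text{ for all } g \in \Gamma \rangle,$$ that is, the HNN extension of $\Gamma\times\Gamma$ with associated subgroups $\{1\}\times\Gamma$ and $\{(g,g) : g \in \Gamma\}$, and embed $\Gamma$ into $b(\Gamma)$ as $\Gamma \times \{1\}$. Put $b^0(\Gamma) := \Gamma$ and $b^{i}(\Gamma) := b(b^{i-1}(\Gamma))$ for $i \ge 1$. The \emph{universal binate tower} $\beta(\Gamma)$ is the directed union of the groups $b^i(\Gamma)$, $i \in \mathbb{N}$, along these embeddings. \textbf{Proposition.} For every finitely generated group $\Gamma$, the universal binate tower $\beta(\Gamma)$ is a binate group that does not have commuting conjugates. -/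

import Mathlib

/-- A group `G` has commuting conjugates if for every finitely generated subgroup `H` there is
`t : G` such that `[H, t H t⁻¹] = 1`. -/
def HasCommutingConjugates (G : Type*) [Group G] : Prop :=
  ∀ H : Subgroup G, H.FG →
    ∃ t : G, ⁅H, H.map (MulAut.conj t).toMonoidHom⁆ = (⊥ : Subgroup G)

/-- A group `G` is binate if for every finitely generated subgroup `H` there are a homomorphism
`f : H → G` with `[H, f(H)] = 1` and an element `t : G` such that `t f(h) t⁻¹ = h f(h)` for
all `h ∈ H`. -/
def IsBinate (G : Type*) [Group G] : Prop :=
  ∀ H : Subgroup G, H.FG →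
    ∃ f : H →* G, ⁅H, f.range⁆ = (⊥ : Subgroup G) ∧
      ∃ t : G, ∀ h : H, t * f h * t⁻¹ = (h : G) * f h

namespace BinateTower

universe u

section Step

variable (G : Type u) [Group G]

/-- The subgroup `G₊ = {1} × G` of `G × G`. -/
def plus : Subgroup (G × G) := (MonoidHom.inr G G).range

/-- The diagonal subgroup `{(g, g)}` of `G × G`. -/
def diag : Subgroup (G × G) := ((MonoidHom.id G).prod (MonoidHom.id G)).range

/-- The isomorphism `(1, g) ↦ (g, g)` from `{1} × G` to the diagonal. -/
def plusEquivDiag : plus G ≃* diag G where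
  toFun x := ⟨(x.1.2, x.1.2), x.1.2, rfl⟩
  invFun y := ⟨(1, y.1.2), y.1.2, rfl⟩
  left_inv := by rintro ⟨_, g, rfl⟩; rfl
  right_inv := by rintro ⟨_, g, rfl⟩; rfl
  map_mul' _ _ := rfl

/-- The group `b(G) = ⟨G × G, d ∣ d (1, g) d⁻¹ = (g, g) for all g ∈ G⟩`: the HNN extension of
`G × G` whose stable letter conjugates `{1} × G` to the diagonal via `(1, g) ↦ (g, g)`. -/
abbrev Step : Type u := HNNExtension (G × G) (plus G) (diag G) (plusEquivDiag G)

/-- The embedding of `G` in `b(G)` as `G₋ = G × {1}`. -/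
def stepEmb : G →* Step G := HNNExtension.of.comp (MonoidHom.inl G G)

/-- The iterates `b⁰(G) = G`, `bⁱ⁺¹(G) = b(bⁱ(G))`. -/
def level : ℕ → GrpCat.{u}
  | 0 => GrpCat.of G
  | n + 1 => GrpCat.of (Step (level n))

/-- The composite `bⁱ(G) → bⁱ⁺¹(G) → ⋯ → bʲ(G)` of the embeddings `stepEmb`. -/
def levelMap (i j : ℕ) (h : i ≤ j) : level G i →* level G j :=
  Nat.leRecOn (C := fun k => level G i →* level G k) h
    (fun {k} f => (stepEmb (level G k)).comp f) (MonoidHom.id (level G i))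

theorem levelMap_self (i : ℕ) (h : i ≤ i) : levelMap G i i h = MonoidHom.id (level G i) :=
  Nat.leRecOn_self _

theorem levelMap_succ (i j : ℕ) (h : i ≤ j) (h' : i ≤ j + 1) :
    levelMap G i (j + 1) h' = (stepEmb (level G j)).comp (levelMap G i j h) :=
  Nat.leRecOn_succ h _

instance levelMap_directedSystem :
    DirectedSystem (fun i => level G i) (fun i j h => levelMap G i j h) where
  map_self i x := by rw [levelMap_self]; rfl
  map_map k j i hij hjk x := by
    induction k, hjk using Nat.le_induction with
    | base => rw [levelMap_self]; rfl
    | succ k hjk ih =>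
      rw [levelMap_succ G j k hjk, levelMap_succ G i k (hij.trans hjk)]
      exact congrArg (stepEmb (level G k)) ih

end Step

end BinateTower

/-- The universal binate tower `β(G)`: the directed union of `bⁱ(G)`, `i ∈ ℕ`, along the
embeddings of `bⁱ(G)` in `bⁱ⁺¹(G)` as `bⁱ(G) × {1}`. -/
abbrev UniversalBinateTower (G : Type*) [Group G] : Type _ :=
  DirectLimit (fun i => BinateTower.level G i) (fun i j h => BinateTower.levelMap G i j h)

/-! A finitely generated `H` lies in some `bⁿ(Γ)`; in `bⁿ⁺¹(Γ)` the second factor supplies `f` and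
the stable letter supplies `t`, so the tower is binate. For the negative part, take `g ≠ 1` in `G`
and `x` in `b(G)` with `(g, 1)` commuting with its conjugate by `x`. No conjugate of `(g, 1)` in `G
× G` meets the associated subgroups, so Britton's lemma (`mem_range_of_of_mul_eq_mul_of`) forces `x
∈ G × G`, and its first coordinate does the same job in `G`. Descending level by level, a conjugator
for `b²(Γ)` could be chosen inside `b²(Γ)`, making that group abelian, which it is not. -/

namespace HNNExtension

variable {G : Type*} [Group G] {A B : Subgroup G} {φ : A ≃* B}

/-- Right multiplication by an element of the base group only changes the last letter of a nonempty
reduced list. -/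
theorem exists_list_prod_mul_of (k : G) (l : List (ℤˣ × G)) (hl : l ≠ [])
    (hc : l.IsChain (fun a b => a.2 ∈ toSubgroup A B a.1 → a.1 = b.1)) :
    ∃ l' : List (ℤˣ × G), l'.IsChain (fun a b => a.2 ∈ toSubgroup A B a.1 → a.1 = b.1) ∧
      l'.map Prod.fst = l.map Prod.fst ∧
      (l'.map (fun x => (t : HNNExtension G A B φ) ^ (x.1 : ℤ) * of x.2)).prod =
        (l.map (fun x => t ^ (x.1 : ℤ) * of x.2)).prod * of k := by
  induction l with
  | nil => exact absurd rfl hl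
  | cons a l ih =>
    rcases l with _ | ⟨b, l⟩
    · exact ⟨[(a.1, a.2 * k)], List.isChain_singleton _, rfl, by simp [mul_assoc]⟩
    · rw [List.isChain_cons_cons] at hc
      obtain ⟨l', hc', hm, hp⟩ := ih (by simp) hc.2
      rcases l' with _ | ⟨b', l'⟩
      · simp at hm
      · refine ⟨a :: b' :: l', List.isChain_cons_cons.2 ⟨fun h => ?_, hc'⟩, ?_, ?_⟩
        · rw [hc.1 h]
          simp only [List.map_cons, List.cons.injEq] at hm
          exact hm.1.symm
        · rw [List.map_cons, hm, ← List.map_cons]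
        · rw [List.map_cons, List.prod_cons, hp, ← mul_assoc, ← List.prod_cons]; rfl

theorem exists_reducedWord_prod_eq (z : HNNExtension G A B φ) :
    ∃ w : NormalWord.ReducedWord G A B, w.prod φ = z := by
  obtain ⟨d⟩ := NormalWord.TransversalPair.nonempty G A B
  exact ⟨((NormalWord.equiv φ d) z).toReducedWord, (NormalWord.equiv φ d).symm_apply_apply z⟩

/-- An element conjugating into the base group an element of the base group, no conjugate of which
lies in an associated subgroup, lies itself in the base group. -/
theorem mem_range_of_of_mul_eq_mul_of {g k : G} (hg : ∀ (u : ℤˣ) (x : G),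
    x⁻¹ * g * x ∉ toSubgroup A B u) {z : HNNExtension G A B φ} (h : of g * z = z * of k) :
    z ∈ (of : G →* HNNExtension G A B φ).range := by
  obtain ⟨w, rfl⟩ := exists_reducedWord_prod_eq z
  obtain ⟨x, l, hc⟩ := w
  by_cases hl : l = []
  · subst hl
    exact ⟨x, by simp [NormalWord.ReducedWord.prod]⟩
  exfalso
  obtain ⟨l', hc', hm, hp⟩ := exists_list_prod_mul_of (φ := φ) k l hl hc
  -- `g z` and `z k` are reduced words for one element, with heads `g x` and `x`; uniqueness of the
  -- head's coset puts `x⁻¹ g x` in an associated subgroup.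
  have key := (ReducedWord.map_fst_eq_and_of_prod_eq φ
    (w₁ := ⟨x, l', hc'⟩) (w₂ := ⟨g * x, l, hc⟩) (by
      simp only [NormalWord.ReducedWord.prod] at h ⊢
      rw [hp, ← mul_assoc, ← h, map_mul, mul_assoc])).2
  rcases l' with _ | ⟨a, l'⟩
  · exact hl (List.map_eq_nil_iff.1 hm.symm)
  · exact hg (-a.1) x (by simpa [mul_assoc] using key a.1 (by simp))

theorem closure_range_of_union_t :
    Subgroup.closure (Set.range (of : G →* HNNExtension G A B φ) ∪ {t}) = ⊤ := by
  refine eq_top_iff.2 fun x _ => ?_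
  induction x using induction_on with
  | of g => exact Subgroup.subset_closure (Or.inl ⟨g, rfl⟩)
  | t => exact Subgroup.subset_closure (Or.inr rfl)
  | mul x y hx hy => exact mul_mem (hx trivial) (hy trivial)
  | inv x hx => exact inv_mem (hx trivial)

instance [Group.FG G] : Group.FG (HNNExtension G A B φ) := by
  rw [Group.fg_def, ← closure_range_of_union_t, Subgroup.closure_union, ← MonoidHom.coe_range,
    Subgroup.closure_eq]
  exact ((Group.fg_iff_subgroup_fg _).1 inferInstance).sup
    ((Subgroup.fg_iff _).2 ⟨{t}, rfl, Set.finite_singleton t⟩)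

/-- The stable letter maps to a generator of `ℤ` when the base is killed. -/
instance : Nontrivial (HNNExtension G A B φ) := by
  refine ⟨t, 1, fun h => ?_⟩
  have := congrArg (lift (φ := φ) (1 : G →* Multiplicative ℤ) (Multiplicative.ofAdd (1 : ℤ))
    (by simp)) h
  rw [lift_t] at this
  exact one_ne_zero (Multiplicative.ofAdd.injective (this.trans (map_one _)))

end HNNExtension

namespace BinateTower

open HNNExtension

section Step

variable {G : Type*} [Group G]

theorem mem_plus {x : G × G} : x ∈ plus G ↔ x.1 = 1 :=
  ⟨by rintro ⟨g, rfl⟩; rfl, fun h => ⟨x.2, Prod.ext h.symm rfl⟩⟩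

theorem mem_diag {x : G × G} : x ∈ diag G ↔ x.1 = x.2 :=
  ⟨by rintro ⟨g, rfl⟩; rfl, fun h => ⟨x.2, Prod.ext h.symm rfl⟩⟩

theorem stepEmb_injective : Function.Injective (stepEmb G) :=
  (of_injective (φ := plusEquivDiag G)).comp fun _ _ h => congrArg Prod.fst h

theorem t_mul_of_inr_mul_inv (g : G) :
    (t : Step G) * of (1, g) * t⁻¹ = of (g, g) :=
  (equiv_eq_conj (φ := plusEquivDiag G) ⟨(1, g), g, rfl⟩).symm

/-- If `t` commuted with `(1, g)`, then `(1, g) = (g, g)`. -/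
theorem exists_not_commute [Nontrivial G] : ∃ a b : Step G, ¬ Commute a b := by
  obtain ⟨g, hg⟩ := exists_ne (1 : G)
  refine ⟨t, of (1, g), fun h => hg ?_⟩
  have := t_mul_of_inr_mul_inv g
  rw [h.eq, mul_inv_cancel_right] at this
  exact (congrArg Prod.fst (of_injective (φ := plusEquivDiag G) this)).symm

theorem conj_inl_notMem_toSubgroup {g : G} (hg : g ≠ 1) (u : ℤˣ) (x : G × G) :
    x⁻¹ * (g, 1) * x ∉ toSubgroup (plus G) (diag G) u := by
  have h : x.1⁻¹ * g * x.1 ≠ 1 := fun h => hg (by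
    have := congrArg (fun y => x.1 * y * x.1⁻¹) h
    simpa [mul_assoc] using this)
  rcases Int.units_eq_one_or u with rfl | rfl
  · rw [toSubgroup_one, mem_plus]
    exact h
  · rw [toSubgroup_neg_one, mem_diag]
    simpa using h

/-- The stable letter cannot help to conjugate a nontrivial subgroup of `G` into its own
centralizer. -/
theorem mem_range_of_commute_conj {g : G} (hg : g ≠ 1) {x : Step G}
    (h : Commute (stepEmb G g) (x * stepEmb G g * x⁻¹)) :
    x ∈ (of : G × G →* Step G).range := by
  -- The criterion is used twice: first for the conjugate of `g` by `x`, which centralizes `g`, then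
  -- for `x⁻¹`.
  obtain ⟨k, hk⟩ := mem_range_of_of_mul_eq_mul_of (conj_inl_notMem_toSubgroup hg) h.eq
  rw [← inv_mem_iff]
  refine mem_range_of_of_mul_eq_mul_of (k := k) (conj_inl_notMem_toSubgroup hg) ?_
  rw [hk]
  change stepEmb G g * x⁻¹ = _
  group

/-- Keeping `H` arbitrary allows iteration: `y` serves the same `H`, which may come from a lower
level. -/
theorem exists_commute_conj_of_step {H : Subgroup G} (hH : H ≠ ⊥) {x : Step G}
    (h : ∀ a ∈ H, ∀ b ∈ H, Commute (stepEmb G a) (x * stepEmb G b * x⁻¹)) :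
    ∃ y : G, ∀ a ∈ H, ∀ b ∈ H, Commute a (y * b * y⁻¹) := by
  obtain ⟨g, hgH, hg⟩ := H.bot_or_exists_ne_one.resolve_left hH
  obtain ⟨y, rfl⟩ := mem_range_of_commute_conj hg (h g hgH g hgH)
  refine ⟨y.1, fun a ha b hb => ?_⟩
  have := (h a ha b hb).eq
  simp only [stepEmb, MonoidHom.comp_apply, ← map_mul, ← map_inv] at this
  exact congrArg Prod.fst (of_injective (φ := plusEquivDiag G) this)

end Step

universe u

variable (G : Type u) [Group G]

theorem levelMap_injective (i j : ℕ) (h : i ≤ j) : Function.Injective (levelMap G i j h) := by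
  induction j, h using Nat.le_induction with
  | base => rw [levelMap_self]; exact Function.injective_id
  | succ j h ih => rw [levelMap_succ G i j h]; exact stepEmb_injective.comp ih

instance level_fg [Group.FG G] : ∀ n, Group.FG (level G n)
  | 0 => inferInstanceAs (Group.FG G)
  | n + 1 =>
    have := level_fg n
    inferInstanceAs (Group.FG (Step (level G n)))

/-- The inclusion of `bⁿ(G)` in the universal binate tower. -/
def toTower (n : ℕ) : level G n →* UniversalBinateTower G where
  toFun x := ⟦⟨n, x⟩⟧
  map_one' := (DirectLimit.one_def (f := levelMap G) n).symm
  map_mul' x y := (DirectLimit.mul_def (f := levelMap G) n x y).symm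

theorem toTower_injective (n : ℕ) : Function.Injective (toTower G n) :=
  DirectLimit.mk_injective _ (levelMap_injective G) n

theorem toTower_levelMap (i j : ℕ) (h : i ≤ j) (x : level G i) :
    toTower G j (levelMap G i j h x) = toTower G i x :=
  (DirectLimit.eq_of_le (f := levelMap G) (⟨i, x⟩ : Σ i, level G i) j h).symm

theorem toTower_stepEmb (n : ℕ) (x : level G n) :
    toTower G (n + 1) (stepEmb (level G n) x) = toTower G n x := by
  rw [← toTower_levelMap G n (n + 1) n.le_succ x, levelMap_succ G n n le_rfl, levelMap_self]
  rfl

theorem range_toTower_mono : Monotone fun n => (toTower G n).range := by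
  rintro i j h _ ⟨x, rfl⟩
  exact ⟨levelMap G i j h x, toTower_levelMap G i j h x⟩

theorem exists_mem_range_toTower (x : UniversalBinateTower G) :
    ∃ n, x ∈ (toTower G n).range := by
  obtain ⟨n, y, rfl⟩ := DirectLimit.exists_eq_mk _ x
  exact ⟨n, y, rfl⟩

theorem exists_le_range_toTower {H : Subgroup (UniversalBinateTower G)} (hH : H.FG) :
    ∃ n, H ≤ (toTower G n).range := by
  obtain ⟨s, rfl⟩ := hH
  choose N hN using exists_mem_range_toTower G
  refine ⟨s.sup N, (Subgroup.closure_le _).2 fun x hx => ?_⟩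
  exact range_toTower_mono G (Finset.le_sup hx) (hN x)

theorem isBinate : IsBinate (UniversalBinateTower G) := by
  intro H hH
  obtain ⟨n, hn⟩ := exists_le_range_toTower G hH
  let p : H →* level G n :=
    (MonoidHom.ofInjective (toTower_injective G n)).symm.toMonoidHom.comp (Subgroup.inclusion hn)
  have hp (h : H) : toTower G n (p h) = h :=
    congrArg Subtype.val
      ((MonoidHom.ofInjective (toTower_injective G n)).apply_symm_apply (Subgroup.inclusion hn h))
  let q : Step (level G n) →* UniversalBinateTower G := toTower G (n + 1)
  have hq (h : H) : q (of (p h, 1)) = h := (toTower_stepEmb G n (p h)).trans (hp h)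
  refine ⟨(q.comp of).comp ((MonoidHom.inr _ _).comp p), ?_, q t, fun h => ?_⟩
  · rw [Subgroup.commutator_eq_bot_iff_le_centralizer]
    rintro a ha
    rw [Subgroup.mem_centralizer_iff]
    rintro _ ⟨b, rfl⟩
    rw [← show _ = a from hq ⟨a, ha⟩]
    change q (of (1, p b)) * q (of (p ⟨a, ha⟩, 1)) = q (of (p ⟨a, ha⟩, 1)) * q (of (1, p b))
    rw [← map_mul, ← map_mul, ← map_mul, ← map_mul]
    simp
  · rw [← hq h]
    change q t * q (of (1, p h)) * (q t)⁻¹ = q (of (p h, 1)) * q (of (1, p h))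
    rw [← map_inv, ← map_mul, ← map_mul, ← map_mul, ← map_mul, Prod.mk_mul_mk, mul_one, one_mul,
      t_mul_of_inr_mul_inv]

/-- Elements of higher levels of the tower do not help to conjugate a nontrivial level into its own
centralizer. -/
theorem exists_commute_conj_of_levelMap (m n : ℕ) (h : m ≤ n) [Nontrivial (level G m)]
    (x : level G n)
    (hx : ∀ a b, Commute (levelMap G m n h a) (x * levelMap G m n h b * x⁻¹)) :
    ∃ y : level G m, ∀ a b, Commute a (y * b * y⁻¹) := by
  induction n, h using Nat.le_induction with
  | base => exact ⟨x, by simpa [levelMap_self] using hx⟩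
  | succ n h ih =>
    have hbot : (levelMap G m n h).range ≠ ⊥ := fun hb => by
      obtain ⟨g, hg⟩ := exists_ne (1 : level G m)
      have : levelMap G m n h g ∈ (levelMap G m n h).range := ⟨g, rfl⟩
      rw [hb, Subgroup.mem_bot] at this
      exact hg (levelMap_injective G m n h (this.trans (map_one _).symm))
    obtain ⟨y, hy⟩ := exists_commute_conj_of_step (G := level G n) hbot (x := x) (by
      rintro _ ⟨a, rfl⟩ _ ⟨b, rfl⟩
      have := hx a b
      rwa [levelMap_succ G m n h] at this)
    exact ih y fun a b => hy _ ⟨a, rfl⟩ _ ⟨b, rfl⟩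

theorem not_hasCommutingConjugates [Group.FG G] :
    ¬ HasCommutingConjugates (UniversalBinateTower G) := by
  intro hcc
  -- Level 2 is used because `Γ` may be trivial, and then level 1 is infinite cyclic.
  have : Nontrivial (level G 1) := inferInstanceAs (Nontrivial (Step (level G 0)))
  have : Nontrivial (level G 2) := inferInstanceAs (Nontrivial (Step (level G 1)))
  obtain ⟨s, hs⟩ := hcc (toTower G 2).range ((Group.fg_iff_subgroup_fg _).1 inferInstance)
  rw [Subgroup.commutator_eq_bot_iff_le_centralizer] at hs
  obtain ⟨k, x, hx⟩ := exists_mem_range_toTower G s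
  obtain ⟨n, hn, x, rfl⟩ : ∃ n, 2 ≤ n ∧ s ∈ (toTower G n).range :=
    ⟨max 2 k, le_max_left _ _, range_toTower_mono G (le_max_right 2 k) ⟨x, hx⟩⟩
  obtain ⟨y, hy⟩ := exists_commute_conj_of_levelMap G 2 n hn x fun a b => by
    have := Subgroup.mem_centralizer_iff.1 (hs ⟨a, rfl⟩) _
      (Subgroup.mem_map_of_mem _ ⟨b, rfl⟩)
    apply toTower_injective G n
    simpa [toTower_levelMap] using this.symm
  obtain ⟨a, b, hab⟩ : ∃ a b : level G 2, ¬ Commute a b := exists_not_commute (G := level G 1)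
  apply hab
  -- As `y` lies in level 2 itself, every `b` is a conjugate by `y` of an element of that level.
  have := hy a (y⁻¹ * b * y)
  rwa [show y * (y⁻¹ * b * y) * y⁻¹ = b by group] at this

end BinateTower

theorem mainTheorem1 (Γ : Type*) [Group Γ] [Group.FG Γ] :
    IsBinate (UniversalBinateTower Γ) ∧
      ¬ HasCommutingConjugates (UniversalBinateTower Γ) :=
  ⟨BinateTower.isBinate Γ, BinateTower.not_hasCommutingConjugates Γ⟩
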